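/- Let $k$ be an algebraically closed field of characteristic $2$, let $r\ge 0$, and let $S=k[x_1,\dots,x_r]$ be the polynomial algebra, $\mathbb{Z}$-graded so that every $x_i$ has degree $-1$. A differential graded (dg) $S$-module $(M,\partial)$ is a $\mathbb{Z}$-graded $S$-module $M=\bigoplus_{n\in\mathbb{Z}}M_n$ with an $S$-linear endomorphism $\partial$ of degree $-1$ (that is, $\partial(M_n)\subseteq M_{n-1}$) such that $\partial^2=0$; its homology is $H(M)=\bigoplus_{n}H_n(M)$, where $H_n(M)=\ker(\partial|_{M_n})/\partial(M_{n+1})$. It is called semifree if its underlying graded $S$-module is free, that is, has an $S$-basis of homogeneous elements. Let $(M,\partial)$ be a semifree dg $S$-module such that $H(M)$ is nonzero and finite-dimensional over $k$, and suppose that $n$ and $m$ have the same parity whenever $H_n(M)\neq 0$ and $H_m(M)\neq 0$. Then $\operatorname{rank}_S M\ge 2^r$. -/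

import Mathlib

open scoped DirectSum

universe u v

/-- The `ℤ`-grading of `S = k[x₁, …, x_r]` in which every variable has degree `-1`. -/
noncomputable def polyGrading (k : Type u) [Field k] (r : ℕ) :
    ℤ → Submodule k (MvPolynomial (Fin r) k) :=
  MvPolynomial.weightedHomogeneousSubmodule k (fun _ : Fin r => (-1 : ℤ))

/-- A structure of differential graded module over `S = k[x₁, …, x_r]` (variables of degree `-1`)
on the `S`-module `M`: a `ℤ`-grading making `M` a graded `S`-module, and an `S`-linear
endomorphism `d` of degree `-1` with `d² = 0`. -/
structure DGModule (k : Type u) [Field k] (r : ℕ) (M : Type v) [AddCommGroup M] [Module k M]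
    [Module (MvPolynomial (Fin r) k) M] [IsScalarTower k (MvPolynomial (Fin r) k) M] where
  /-- the homogeneous component of each degree -/
  component : ℤ → Submodule k M
  /-- `M` is the internal direct sum of its homogeneous components -/
  isInternal : DirectSum.IsInternal component
  /-- multiplication is compatible with the gradings of `S` and `M` -/
  smul_mem : ∀ (m n : ℤ) (s : MvPolynomial (Fin r) k) (x : M),
    s ∈ polyGrading k r m → x ∈ component n → s • x ∈ component (m + n)
  /-- the differential -/
  d : M →ₗ[MvPolynomial (Fin r) k] M
  /-- the differential has degree `-1` -/
  d_mem : ∀ (n : ℤ) (x : M), x ∈ component n → d x ∈ component (n - 1)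
  /-- the differential squares to zero -/
  d_d : ∀ x : M, d (d x) = 0

namespace DGModule

variable {k : Type u} [Field k] {r : ℕ} {M : Type v} [AddCommGroup M] [Module k M]
  [Module (MvPolynomial (Fin r) k) M] [IsScalarTower k (MvPolynomial (Fin r) k) M]

/-- A dg module is semifree if its underlying graded `S`-module is free, that is, if it has an
`S`-basis consisting of homogeneous elements. -/
def IsSemifree (D : DGModule k r M) : Prop :=
  ∃ (ι : Type v) (b : Module.Basis ι (MvPolynomial (Fin r) k) M),
    ∀ i : ι, ∃ n : ℤ, b i ∈ D.component n

/-- The `n`-cycles. -/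
noncomputable def cycles (D : DGModule k r M) (n : ℤ) : Submodule k M :=
  D.component n ⊓ LinearMap.ker (D.d.restrictScalars k)

/-- The `n`-boundaries. -/
noncomputable def boundaries (D : DGModule k r M) (n : ℤ) : Submodule k M :=
  (D.component (n + 1)).map (D.d.restrictScalars k)

theorem boundaries_le_cycles (D : DGModule k r M) (n : ℤ) : D.boundaries n ≤ D.cycles n := by
  rintro _ ⟨x, hx, rfl⟩
  refine ⟨?_, ?_⟩
  · simpa using D.d_mem (n + 1) x hx
  · simpa using D.d_d x

/-- The homology group `H_n(M)`, cycles modulo boundaries, as a `k`-vector space. -/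
abbrev homology (D : DGModule k r M) (n : ℤ) : Type v :=
  D.cycles n ⧸ (D.boundaries n).submoduleOf (D.cycles n)

end DGModule

/-! Fold `M` modulo 2 into a two-periodic complex `A ⇄ B`, where `A` is the parity carrying the
homology, and put `χ = dim H_A - dim H_B`. Each variable `x` has odd degree and commutes with the
differential, so it interchanges the parities. When `x` is injective, the sequence `0 → M → M → M/xM
→ 0` gives a six-term exact sequence. Because `x` swaps the parities, the two copies of `M`
contribute with the same sign and `χ(M/xM) = 2 χ(M)` (`euler_char`); an even `x` would give `0`.

Freeness makes the variables a regular sequence on `M` (`X_smul_mem_initialSubmodule`), so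
`χ(M/(x₁,…,x_r)M) = 2^r χ(M)` (`euler_char_regular_sequence`). By the parity hypothesis `H_B(M) =
0`, hence `χ(M) = dim H_A(M) ≥ 1`. On the other side, `χ` of the last quotient is at most the
dimension of its `A`-part, which is at most the rank of `M` (`finite_and_finrank_same_quotient_le`).

The successive quotients are encoded by growing submodules `NA`, `NB` of the fixed spaces `A`, `B`,
so the induction never changes the underlying complex. -/

/-- The subquotient `P / (P ∩ Q)` of a vector space. -/
abbrev Subquotient {k A : Type*} [Field k] [AddCommGroup A] [Module k A]
    (P Q : Submodule k A) : Type _ := P ⧸ Q.submoduleOf P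

/-! ### Subquotients of vector spaces. -/

namespace Subquotient

variable {k A B : Type*} [Field k] [AddCommGroup A] [Module k A] [AddCommGroup B] [Module k B]

/-- The map of subquotients induced by a linear map. -/
def map (P Q : Submodule k A) (P' Q' : Submodule k B) (f : A →ₗ[k] B)
    (hP : ∀ a ∈ P, f a ∈ P') (hQ : ∀ a ∈ Q, f a ∈ Q') :
    Subquotient P Q →ₗ[k] Subquotient P' Q' :=
  Submodule.mapQ _ _ (f.restrict hP) fun a ha => hQ a ha

theorem mk_eq_mk_iff {P Q : Submodule k A} (a b : P) :
    ((Submodule.Quotient.mk a : Subquotient P Q) = Submodule.Quotient.mk b) ↔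
      (a : A) - b ∈ Q := by
  rw [Submodule.Quotient.eq]; rfl

theorem mk_eq_zero_iff {P Q : Submodule k A} (a : P) :
    ((Submodule.Quotient.mk a : Subquotient P Q) = 0) ↔ (a : A) ∈ Q := by
  rw [Submodule.Quotient.mk_eq_zero]; rfl

end Subquotient

/-! ### The six-term exact sequence of an injective odd endomorphism. -/

section RelativeHomology

variable {k A B : Type*} [Field k] [AddCommGroup A] [Module k A] [AddCommGroup B] [Module k B]

/-- For a two-periodic complex `A ⇄ B` with subcomplex `NA ⇄ NB`, the homology at `A / NA` of the
quotient complex. -/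
abbrev RelHomology (d : A →ₗ[k] B) (d' : B →ₗ[k] A) (NA : Submodule k A) (NB : Submodule k B) :
    Type _ :=
  Subquotient (NB.comap d) (LinearMap.range d' ⊔ NA)

/-- The two-periodic complex `d, d'` with a subcomplex `NA, NB` and an odd endomorphism `x, y`
commuting with the differential, which is injective modulo the subcomplex. -/
structure RegularOddEndo (d : A →ₗ[k] B) (d' : B →ₗ[k] A) (x : A →ₗ[k] B) (y : B →ₗ[k] A)
    (NA : Submodule k A) (NB : Submodule k B) : Prop where
  d'_d : ∀ a, d' (d a) = 0
  d_d' : ∀ b, d (d' b) = 0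
  d_mem : ∀ a ∈ NA, d a ∈ NB
  d'_mem : ∀ b ∈ NB, d' b ∈ NA
  y_d : ∀ a, y (d a) = d' (x a)
  x_d' : ∀ b, x (d' b) = d (y b)
  x_mem_iff : ∀ a, x a ∈ NB ↔ a ∈ NA
  y_mem_iff : ∀ b, y b ∈ NA ↔ b ∈ NB

namespace RegularOddEndo

variable {d : A →ₗ[k] B} {d' : B →ₗ[k] A} {x : A →ₗ[k] B} {y : B →ₗ[k] A}
  {NA : Submodule k A} {NB : Submodule k B}

theorem swap (h : RegularOddEndo d d' x y NA NB) : RegularOddEndo d' d y x NB NA :=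
  ⟨h.d_d', h.d'_d, h.d'_mem, h.d_mem, h.x_d', h.y_d, h.y_mem_iff, h.x_mem_iff⟩

/-- The map induced on relative homology by an odd endomorphism. -/
def homologyMap (h : RegularOddEndo d d' x y NA NB) :
    RelHomology d d' NA NB →ₗ[k] RelHomology d' d NB NA :=
  Subquotient.map _ _ _ _ x
    (fun a ha => by
      rw [Submodule.mem_comap] at ha ⊢
      rw [← h.y_d]
      exact (h.y_mem_iff _).2 ha)
    (fun a ha => by
      obtain ⟨_, ⟨b, rfl⟩, n, hn, rfl⟩ := Submodule.mem_sup.1 ha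
      rw [map_add, h.x_d']
      exact Submodule.add_mem_sup ⟨_, rfl⟩ ((h.x_mem_iff _).2 hn))

/-- The projection from homology to the homology of the quotient by the odd endomorphism. -/
def projection (d : A →ₗ[k] B) (d' : B →ₗ[k] A) (x : A →ₗ[k] B) (y : B →ₗ[k] A)
    (NA : Submodule k A) (NB : Submodule k B) :
    RelHomology d d' NA NB →ₗ[k]
      RelHomology d d' (NA ⊔ LinearMap.range y) (NB ⊔ LinearMap.range x) :=
  Subquotient.map _ _ _ _ LinearMap.id
    (fun _ ha => Submodule.mem_sup_left (S := NB) ha)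
    (fun _ ha => (sup_le_sup_left le_sup_left _ : LinearMap.range d' ⊔ NA ≤ _) ha)

/-- Exactness at the homology of the complex itself. The other half of the exact sequence is
`cokernelEquiv`. -/
theorem ker_projection (h : RegularOddEndo d d' x y NA NB) :
    LinearMap.ker (projection d d' x y NA NB) = LinearMap.range h.swap.homologyMap := by
  ext q
  obtain ⟨⟨a, ha⟩, rfl⟩ := Submodule.Quotient.mk_surjective _ q
  rw [Submodule.mem_comap] at ha
  rw [LinearMap.mem_ker]
  refine (Subquotient.mk_eq_zero_iff (P := (NB ⊔ LinearMap.range x).comap d)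
    ⟨a, Submodule.mem_sup_left ha⟩).trans ?_
  constructor
  · intro hq
    obtain ⟨_, ⟨b, rfl⟩, _, hm, rfl⟩ := Submodule.mem_sup.1 hq
    obtain ⟨n, hn, _, ⟨c, rfl⟩, rfl⟩ := Submodule.mem_sup.1 hm
    -- Applying `d` to `a = d' b + n + y c` leaves `d (y c) = x (d' c)` in `NB`, and `x` cancels
    -- modulo the subcomplex.
    have hc : c ∈ NA.comap d' := by
      rw [Submodule.mem_comap, ← h.x_mem_iff, h.x_d']
      simp only [map_add, h.d_d', zero_add] at ha
      exact (NB.add_mem_iff_right (h.d_mem n hn)).1 ha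
    refine ⟨Submodule.Quotient.mk ⟨c, hc⟩, ?_⟩
    refine (Subquotient.mk_eq_mk_iff _ _).2 ?_
    have : y c - (d' b + (n + y c)) = d' (-b) + -n := by rw [map_neg]; abel
    exact this ▸ Submodule.add_mem_sup ⟨_, rfl⟩ (NA.neg_mem hn)
  · rintro ⟨q, hq⟩
    obtain ⟨⟨c, hc⟩, rfl⟩ := Submodule.Quotient.mk_surjective _ q
    have := (Subquotient.mk_eq_mk_iff _ _).1 hq
    change y c - a ∈ _ at this
    have h2 : a = y c - (y c - a) := by abel
    change a ∈ _
    rw [h2]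
    refine sub_mem (Submodule.mem_sup_right (Submodule.mem_sup_right ⟨c, rfl⟩)) ?_
    exact (sup_le_sup_left le_sup_left _ : LinearMap.range d' ⊔ NA ≤ _) this

/-- The pairs `(a, w)` with `d a ≡ x w`: the graph of the connecting homomorphism. -/
def connectingRel (d : A →ₗ[k] B) (x : A →ₗ[k] B) (NB : Submodule k B) : Submodule k (A × A) :=
  NB.comap (d ∘ₗ LinearMap.fst k A A - x ∘ₗ LinearMap.snd k A A)

theorem mem_connectingRel {a w : A} : (a, w) ∈ connectingRel d x NB ↔ d a - x w ∈ NB := Iff.rfl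

theorem fst_mem (p : A × A) (hp : p ∈ connectingRel d x NB) :
    p.1 ∈ (NB ⊔ LinearMap.range x).comap d := by
  have : d p.1 = (d p.1 - x p.2) + x p.2 := by abel
  rw [Submodule.mem_comap, this]
  exact Submodule.add_mem_sup hp ⟨_, rfl⟩

/-- Applying `d'` to `d a - x w` gives `-y (d w)`, and `y` cancels modulo the subcomplex. -/
theorem snd_mem (h : RegularOddEndo d d' x y NA NB) (p : A × A)
    (hp : p ∈ connectingRel d x NB) : p.2 ∈ NB.comap d := by
  have h1 := h.d'_mem _ (mem_connectingRel.1 hp)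
  rw [map_sub, h.d'_d, zero_sub, neg_mem_iff, ← h.y_d] at h1
  exact (h.y_mem_iff _).1 h1

/-- The class in the cokernel of the projection of the source of a connecting pair. -/
def sourceClass (d : A →ₗ[k] B) (d' : B →ₗ[k] A) (x : A →ₗ[k] B) (y : B →ₗ[k] A)
    (NA : Submodule k A) (NB : Submodule k B) :
    connectingRel d x NB →ₗ[k]
      RelHomology d d' (NA ⊔ LinearMap.range y) (NB ⊔ LinearMap.range x) ⧸
        LinearMap.range (projection d d' x y NA NB) :=
  (Submodule.mkQ _) ∘ₗ (Submodule.mkQ _) ∘ₗ (LinearMap.fst k A A).restrict fst_mem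

/-- The homology class of the target of a connecting pair. -/
def targetClass (h : RegularOddEndo d d' x y NA NB) :
    connectingRel d x NB →ₗ[k] RelHomology d d' NA NB :=
  (Submodule.mkQ _) ∘ₗ (LinearMap.snd k A A).restrict h.snd_mem

theorem sourceClass_surjective :
    Function.Surjective (sourceClass d d' x y NA NB) := by
  intro q
  obtain ⟨q, rfl⟩ := Submodule.Quotient.mk_surjective _ q
  obtain ⟨⟨a, ha⟩, rfl⟩ := Submodule.Quotient.mk_surjective _ q
  rw [Submodule.mem_comap] at ha
  obtain ⟨n, hn, _, ⟨w, rfl⟩, e⟩ := Submodule.mem_sup.1 ha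
  exact ⟨⟨(a, w), mem_connectingRel.2 (by rwa [← e, add_sub_cancel_right])⟩, rfl⟩

theorem range_targetClass (h : RegularOddEndo d d' x y NA NB) :
    LinearMap.range h.targetClass = LinearMap.ker h.homologyMap := by
  ext q
  constructor
  · rintro ⟨⟨⟨a, w⟩, hp⟩, rfl⟩
    rw [LinearMap.mem_ker]
    refine (Subquotient.mk_eq_zero_iff _).2 ?_
    change x w ∈ _
    have : x w = d a + -(d a - x w) := by abel
    rw [this]
    exact Submodule.add_mem_sup ⟨_, rfl⟩ (neg_mem hp)
  · obtain ⟨⟨w, hw⟩, rfl⟩ := Submodule.Quotient.mk_surjective _ q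
    intro hq
    have h1 : x w ∈ LinearMap.range d ⊔ NB := (Subquotient.mk_eq_zero_iff _).1 hq
    obtain ⟨_, ⟨a, rfl⟩, n, hn, e⟩ := Submodule.mem_sup.1 h1
    refine ⟨⟨(a, w), mem_connectingRel.2 ?_⟩, rfl⟩
    rw [← e, sub_add_cancel_left]
    exact neg_mem hn

/-- Equality of the kernels says that the connecting relation induces a well-defined and injective
map; with the surjectivity of `sourceClass` and the range of `targetClass` it yields `cokernelEquiv`
without choosing lifts. -/
theorem ker_sourceClass (h : RegularOddEndo d d' x y NA NB) :
    LinearMap.ker (sourceClass d d' x y NA NB) = LinearMap.ker h.targetClass := by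
  ext ⟨⟨a, w⟩, hp⟩
  rw [mem_connectingRel] at hp
  rw [LinearMap.mem_ker, LinearMap.mem_ker]
  refine (Submodule.Quotient.mk_eq_zero _).trans (Iff.trans ?_
    (Subquotient.mk_eq_zero_iff (Q := LinearMap.range d' ⊔ NA) _).symm)
  change _ ↔ w ∈ _
  constructor
  · rintro ⟨q, hq⟩
    obtain ⟨⟨p, hP⟩, rfl⟩ := Submodule.Quotient.mk_surjective _ q
    have h1 := (Subquotient.mk_eq_mk_iff _ _).1 hq
    change p - a ∈ _ at h1
    rw [Submodule.mem_comap] at hP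
    obtain ⟨_, ⟨b, rfl⟩, _, hm, e⟩ := Submodule.mem_sup.1 h1
    obtain ⟨n, hn, _, ⟨c, rfl⟩, rfl⟩ := Submodule.mem_sup.1 hm
    have h2 : w + d' c ∈ NA := by
      rw [← h.x_mem_iff, map_add, h.x_d']
      have h3 : d (p - a) = d n + d (y c) := by rw [← e]; simp [h.d_d']
      have h4 : x w + d (y c) = d p - d n - (d a - x w) := by
        rw [map_sub] at h3
        rw [eq_sub_of_add_eq' h3.symm]; abel
      rw [h4]
      exact sub_mem (sub_mem hP (h.d_mem n hn)) hp
    have h3 : w = d' (-c) + (w + d' c) := by rw [map_neg]; abel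
    rw [h3]
    exact Submodule.add_mem_sup ⟨_, rfl⟩ h2
  · intro hw
    obtain ⟨_, ⟨c, rfl⟩, n, hn, rfl⟩ := Submodule.mem_sup.1 hw
    -- Since `w = d' c + n`, the term `x w` equals `d (y c) + x n`; correcting `a` by `y c` turns it
    -- into a relative cycle.
    have h1 : a - y c ∈ NB.comap d := by
      rw [map_add, h.x_d'] at hp
      have : d (a - y c) = (d a - (d (y c) + x n)) + x n := by rw [map_sub]; abel
      rw [Submodule.mem_comap, this]
      exact add_mem hp ((h.x_mem_iff n).2 hn)
    refine ⟨Submodule.Quotient.mk ⟨a - y c, h1⟩, ?_⟩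
    refine (Subquotient.mk_eq_mk_iff _ _).2 ?_
    change a - y c - a ∈ _
    have : a - y c - a = y (-c) := by rw [map_neg]; abel
    rw [this]
    exact Submodule.mem_sup_right (Submodule.mem_sup_right ⟨_, rfl⟩)

/-- The cokernel of the projection is the kernel of the odd endomorphism on homology. -/
noncomputable def cokernelEquiv (h : RegularOddEndo d d' x y NA NB) :
    (RelHomology d d' (NA ⊔ LinearMap.range y) (NB ⊔ LinearMap.range x) ⧸
        LinearMap.range (projection d d' x y NA NB)) ≃ₗ[k] LinearMap.ker h.homologyMap :=
  ((sourceClass d d' x y NA NB).quotKerEquivOfSurjective sourceClass_surjective).symm ≪≫ₗ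
    Submodule.quotEquivOfEq _ _ h.ker_sourceClass ≪≫ₗ
    h.targetClass.quotKerEquivRange ≪≫ₗ LinearEquiv.ofEq _ _ h.range_targetClass

theorem finite_homology (h : RegularOddEndo d d' x y NA NB)
    [Module.Finite k (RelHomology d d' NA NB)] :
    Module.Finite k (RelHomology d d' (NA ⊔ LinearMap.range y) (NB ⊔ LinearMap.range x)) := by
  have := Module.Finite.equiv h.cokernelEquiv.symm
  exact Module.Finite.of_submodule_quotient (LinearMap.range (projection d d' x y NA NB))

/-- The new homology has dimension `dim ker x_* + (dim H - rank y_*)`, and `dim ker x_* = dim H -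
rank x_*`. -/
theorem finrank_homology (h : RegularOddEndo d d' x y NA NB)
    [Module.Finite k (RelHomology d d' NA NB)] :
    Module.finrank k (RelHomology d d' (NA ⊔ LinearMap.range y) (NB ⊔ LinearMap.range x)) +
      Module.finrank k (LinearMap.range h.homologyMap) +
      Module.finrank k (LinearMap.range h.swap.homologyMap) =
      2 * Module.finrank k (RelHomology d d' NA NB) := by
  have := h.finite_homology
  have h1 := Submodule.finrank_quotient_add_finrank (LinearMap.range (projection d d' x y NA NB))
  have h2 := h.cokernelEquiv.finrank_eq
  have h3 := LinearMap.finrank_range_add_finrank_ker (projection d d' x y NA NB)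
  have h4 := LinearMap.finrank_range_add_finrank_ker h.homologyMap
  rw [h.ker_projection] at h3
  omega

/-- Passing to the quotient by an injective odd endomorphism doubles the Euler characteristic. -/
theorem euler_char (h : RegularOddEndo d d' x y NA NB)
    [Module.Finite k (RelHomology d d' NA NB)] [Module.Finite k (RelHomology d' d NB NA)] :
    (Module.finrank k (RelHomology d d' (NA ⊔ LinearMap.range y) (NB ⊔ LinearMap.range x)) : ℤ) -
      Module.finrank k (RelHomology d' d (NB ⊔ LinearMap.range x) (NA ⊔ LinearMap.range y)) =
      2 * (Module.finrank k (RelHomology d d' NA NB) -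
        Module.finrank k (RelHomology d' d NB NA)) := by
  have h1 := h.finrank_homology
  have h2 := h.swap.finrank_homology
  -- Both parities involve the same two ranks, which therefore cancel in the difference.
  have h3 : h.swap.swap.homologyMap = h.homologyMap := rfl
  rw [h3] at h2
  omega

end RegularOddEndo

end RelativeHomology

/-! ### Iteration along a regular sequence. -/

section Iterate

variable {k A B : Type*} [Field k] [AddCommGroup A] [Module k A] [AddCommGroup B] [Module k B]

/-- Killing a regular sequence of `r` odd endomorphisms multiplies the Euler characteristic by
`2 ^ r`. -/
theorem euler_char_regular_sequence {d : A →ₗ[k] B} {d' : B →ₗ[k] A} {r : ℕ}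
    {x : Fin r → A →ₗ[k] B} {y : Fin r → B →ₗ[k] A}
    {NA : ℕ → Submodule k A} {NB : ℕ → Submodule k B}
    (h : ∀ i : Fin r, RegularOddEndo d d' (x i) (y i) (NA i) (NB i))
    (hA : ∀ i : Fin r, NA (i + 1) = NA i ⊔ LinearMap.range (y i))
    (hB : ∀ i : Fin r, NB (i + 1) = NB i ⊔ LinearMap.range (x i))
    (fA : Module.Finite k (RelHomology d d' (NA 0) (NB 0)))
    (fB : Module.Finite k (RelHomology d' d (NB 0) (NA 0))) (j : ℕ) (hj : j ≤ r) :
    Module.Finite k (RelHomology d d' (NA j) (NB j)) ∧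
    Module.Finite k (RelHomology d' d (NB j) (NA j)) ∧
    (Module.finrank k (RelHomology d d' (NA j) (NB j)) : ℤ) -
      Module.finrank k (RelHomology d' d (NB j) (NA j)) =
      2 ^ j * (Module.finrank k (RelHomology d d' (NA 0) (NB 0)) -
        Module.finrank k (RelHomology d' d (NB 0) (NA 0))) := by
  induction j with
  | zero => exact ⟨fA, fB, by simp⟩
  | succ j ih =>
    obtain ⟨f1, f2, e⟩ := ih (by omega)
    have h' := h ⟨j, hj⟩
    have hA' := hA ⟨j, hj⟩
    have hB' := hB ⟨j, hj⟩
    dsimp only at h' hA' hB'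
    rw [hA', hB']
    refine ⟨h'.finite_homology, h'.swap.finite_homology, ?_⟩
    rw [h'.euler_char, e]
    ring

theorem finrank_relHomology_le (d : A →ₗ[k] B) (d' : B →ₗ[k] A) (NA : Submodule k A)
    (NB : Submodule k B) [Module.Finite k (A ⧸ NA)] :
    Module.finrank k (RelHomology d d' NA NB) ≤ Module.finrank k (A ⧸ NA) := by
  set Q := LinearMap.range d' ⊔ NA
  have hQ : NA ≤ Q := le_sup_right
  have hs : Function.Surjective (Submodule.factor hQ) := Submodule.factor_surjective hQ
  have := Module.Finite.of_surjective _ hs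
  refine le_trans ?_ (LinearMap.finrank_le_finrank_of_surjective hs)
  -- `P / (P ∩ Q)` embeds in `A / Q`, itself a quotient of `A / NA`.
  refine LinearMap.finrank_le_finrank_of_injective
    (f := Submodule.mapQ (Q.submoduleOf (NB.comap d)) Q (NB.comap d).subtype fun _ ha => ha) ?_
  rw [injective_iff_map_eq_zero]
  intro q hq
  obtain ⟨a, rfl⟩ := Submodule.Quotient.mk_surjective _ q
  exact (Subquotient.mk_eq_zero_iff a).2 ((Submodule.Quotient.mk_eq_zero _).1 hq)

end Iterate

/-! ### The variables as a regular sequence on a free module. -/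

section RegularSequence

open MvPolynomial

variable {k : Type u} [Field k] {r : ℕ} {M : Type v} [AddCommGroup M]
  [Module (MvPolynomial (Fin r) k) M]

/-- The ideal generated by the first `j` variables. -/
noncomputable def initialIdeal (k : Type u) [Field k] (r j : ℕ) : Ideal (MvPolynomial (Fin r) k) :=
  Ideal.span (X '' {i : Fin r | (i : ℕ) < j})

/-- The submodule generated by the multiples of the first `j` variables. -/
noncomputable def initialSubmodule (k : Type u) [Field k] (r : ℕ) (M : Type v) [AddCommGroup M]
    [Module (MvPolynomial (Fin r) k) M] (j : ℕ) : Submodule (MvPolynomial (Fin r) k) M :=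
  initialIdeal k r j • ⊤

theorem initialSubmodule_zero : initialSubmodule k r M 0 = ⊥ := by
  simp [initialSubmodule, initialIdeal]

theorem initialIdeal_succ (i : Fin r) :
    initialIdeal k r (i + 1) = initialIdeal k r i ⊔ Ideal.span {X i} := by
  rw [initialIdeal, initialIdeal, ← Ideal.span_union, ← Set.image_singleton, ← Set.image_union]
  congr 2
  ext l
  simp only [Set.mem_ofPred_eq, Set.mem_union, Set.mem_singleton_iff, Fin.ext_iff]
  omega

theorem mem_initialSubmodule_succ (i : Fin r) (m : M) :
    m ∈ initialSubmodule k r M (i + 1) ↔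
      ∃ n ∈ initialSubmodule k r M i, ∃ m', n + (X i : MvPolynomial (Fin r) k) • m' = m := by
  rw [initialSubmodule, initialIdeal_succ, Submodule.sup_smul,
    Submodule.ideal_span_singleton_smul, Submodule.mem_sup]
  refine exists_congr fun n => and_congr_right fun _ => ?_
  constructor
  · rintro ⟨z, hz, rfl⟩
    obtain ⟨m', -, rfl⟩ := Submodule.mem_smul_pointwise_iff_exists _ _ _ |>.1 hz
    exact ⟨m', rfl⟩
  · rintro ⟨m', rfl⟩
    exact ⟨_, Submodule.smul_mem_pointwise_smul _ _ _ trivial, rfl⟩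

/-- The ideal is monomial, and multiplication by `X i` leaves the exponents of the earlier variables
unchanged. -/
theorem X_mul_mem_initialIdeal (i : Fin r) (f : MvPolynomial (Fin r) k)
    (hf : X i * f ∈ initialIdeal k r i) : f ∈ initialIdeal k r i := by
  rw [initialIdeal, mem_ideal_span_X_image] at hf ⊢
  intro m hm
  obtain ⟨l, hl, hne⟩ := hf (Finsupp.single i 1 + m) (by
    rw [mem_support_iff, coeff_X_mul]; exact mem_support_iff.1 hm)
  refine ⟨l, hl, ?_⟩
  have hli : i ≠ l := by rintro rfl; exact lt_irrefl (i : ℕ) hl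
  simpa [Finsupp.single_apply, hli] using hne

theorem mem_ideal_smul_top_iff_repr {R N ι : Type*} [CommRing R] [AddCommGroup N] [Module R N]
    (b : Module.Basis ι R N) (I : Ideal R) (m : N) :
    m ∈ I • (⊤ : Submodule R N) ↔ ∀ i, b.repr m i ∈ I := by
  constructor
  · intro hm i
    induction hm using Submodule.smul_induction_on' with
    | smul f hf n _ => simpa using I.mul_mem_right _ hf
    | add a _ c _ ha hc => simpa using add_mem ha hc
  · intro hm
    rw [← b.linearCombination_repr m, Finsupp.linearCombination_apply]
    exact Submodule.sum_mem _ fun i _ => Submodule.smul_mem_smul (hm i) trivial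

theorem X_smul_mem_initialSubmodule {ι : Type*}
    (b : Module.Basis ι (MvPolynomial (Fin r) k) M) (i : Fin r) (m : M)
    (hm : (X i : MvPolynomial (Fin r) k) • m ∈ initialSubmodule k r M i) :
    m ∈ initialSubmodule k r M i := by
  rw [initialSubmodule, mem_ideal_smul_top_iff_repr b] at hm ⊢
  refine fun l => X_mul_mem_initialIdeal i _ ?_
  simpa using hm l

theorem sub_C_mem_initialIdeal (f : MvPolynomial (Fin r) k) :
    f - C (coeff 0 f) ∈ initialIdeal k r r := by
  rw [initialIdeal, mem_ideal_span_X_image]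
  intro m hm
  have h0 : m ≠ 0 := by
    rintro rfl
    simp at hm
  obtain ⟨l, hl⟩ := Finsupp.ne_iff.1 h0
  exact ⟨l, l.2, hl⟩

variable [Module k M] [IsScalarTower k (MvPolynomial (Fin r) k) M]

/-- Modulo the variables every coefficient reduces to its constant term. -/
theorem span_basis_sup_initialSubmodule {ι : Type*}
    (b : Module.Basis ι (MvPolynomial (Fin r) k) M) :
    Submodule.span k (Set.range b) ⊔ (initialSubmodule k r M r).restrictScalars k = ⊤ := by
  rw [eq_top_iff]
  intro m _
  have : m ∈ Submodule.span (MvPolynomial (Fin r) k) (Set.range b) := by rw [b.span_eq]; trivial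
  induction this using Submodule.span_induction with
  | mem m hm => exact Submodule.mem_sup_left (Submodule.subset_span hm)
  | zero => exact zero_mem _
  | add a c _ _ ha hc => exact add_mem (ha trivial) (hc trivial)
  | smul f a _ ha =>
    have e : f • a = coeff 0 f • a + (f - C (coeff 0 f)) • a := by
      have := algebraMap_smul (MvPolynomial (Fin r) k) (coeff 0 f) a
      rw [sub_smul, ← this, algebraMap_eq, add_sub_cancel]
    rw [e]
    refine add_mem (Submodule.smul_mem _ _ (ha trivial)) (Submodule.mem_sup_right
      (?_ : (f - C (coeff 0 f)) • a ∈ initialSubmodule k r M r))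
    exact (Submodule.smul_mem_smul (sub_C_mem_initialIdeal f) trivial)

/-- A finite-dimensional quotient of `M` killed by all variables has dimension at most the rank. -/
theorem finite_and_finrank_le {ι : Type*} [Fintype ι]
    (b : Module.Basis ι (MvPolynomial (Fin r) k) M) {V : Type*} [AddCommGroup V] [Module k V]
    (φ : M →ₗ[k] V) (hφ : Function.Surjective φ)
    (h0 : ∀ m ∈ initialSubmodule k r M r, φ m = 0) :
    Module.Finite k V ∧ Module.finrank k V ≤ Fintype.card ι := by
  have hs : Submodule.span k (Set.range (φ ∘ b)) = ⊤ := by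
    have h1 := congrArg (Submodule.map φ) (span_basis_sup_initialSubmodule (k := k) b)
    have h2 : ((initialSubmodule k r M r).restrictScalars k).map φ = ⊥ := by
      rw [eq_bot_iff]
      rintro _ ⟨m, hm, rfl⟩
      exact h0 m hm
    rw [Submodule.map_sup, h2, sup_bot_eq, Submodule.map_span, Submodule.map_top,
      LinearMap.range_eq_top.2 hφ, ← Set.range_comp] at h1
    exact h1
  refine ⟨⟨⟨(Set.finite_range (φ ∘ b)).toFinset, by simpa using hs⟩⟩, ?_⟩
  rw [← finrank_top, ← hs]
  exact finrank_range_le_card _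

end RegularSequence

/-! ### Degree and parity projections on a dg module. -/

namespace DGModule

open MvPolynomial

variable {k : Type u} [Field k] {r : ℕ} {M : Type v} [AddCommGroup M] [Module k M]
  [Module (MvPolynomial (Fin r) k) M] [IsScalarTower k (MvPolynomial (Fin r) k) M]

/-- Multiplication by `c n` in degree `n`. -/
noncomputable def weight (D : DGModule k r M) (c : ℤ → k) : M →ₗ[k] M :=
  DirectSum.toModule k ℤ M (fun n => c n • (D.component n).subtype) ∘ₗ
    (LinearEquiv.ofBijective (DirectSum.coeLinearMap D.component)
      (show Function.Bijective (DirectSum.coeLinearMap D.component) from D.isInternal)).symm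

theorem weight_of_mem (D : DGModule k r M) (c : ℤ → k) {n : ℤ} {m : M}
    (hm : m ∈ D.component n) : D.weight c m = c n • m := by
  have hb : Function.Bijective (DirectSum.coeLinearMap D.component) := D.isInternal
  have h : (LinearEquiv.ofBijective (DirectSum.coeLinearMap D.component) hb).symm m =
      DirectSum.lof k ℤ (fun n => D.component n) n ⟨m, hm⟩ := by
    rw [LinearEquiv.symm_apply_eq, LinearEquiv.ofBijective_apply, DirectSum.coeLinearMap_lof]
  rw [weight, LinearMap.comp_apply, LinearEquiv.coe_coe, h, DirectSum.toModule_lof]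
  rfl

theorem homogeneous_induction (D : DGModule k r M) {p : M → Prop}
    (hom : ∀ n, ∀ m ∈ D.component n, p m) (add : ∀ a b, p a → p b → p (a + b)) (m : M) : p m := by
  have hm : m ∈ ⨆ n, D.component n := by
    rw [D.isInternal.submodule_iSup_eq_top]; trivial
  exact Submodule.iSup_induction D.component (motive := p) hm hom (hom 0 0 (zero_mem _)) add

theorem weight_mul (D : DGModule k r M) (c c' : ℤ → k) (m : M) :
    D.weight c (D.weight c' m) = D.weight (c * c') m := by
  induction m using D.homogeneous_induction with
  | hom n m hm =>
    rw [D.weight_of_mem c' hm, map_smul, D.weight_of_mem c hm, D.weight_of_mem _ hm, smul_smul,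
      Pi.mul_apply, mul_comm]
  | add a b ha hb => simp only [map_add, ha, hb]

theorem weight_d (D : DGModule k r M) (c : ℤ → k) (m : M) :
    D.weight c (D.d m) = D.d (D.weight (fun n => c (n - 1)) m) := by
  induction m using D.homogeneous_induction with
  | hom n m hm =>
    rw [D.weight_of_mem _ hm, D.weight_of_mem _ (D.d_mem n m hm), LinearMap.map_smul_of_tower]
  | add a b ha hb => simp only [map_add, ha, hb]

theorem X_smul_mem (D : DGModule k r M) (i : Fin r) {n : ℤ} {m : M} (hm : m ∈ D.component n) :
    (X i : MvPolynomial (Fin r) k) • m ∈ D.component (n - 1) := by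
  have h : (X i : MvPolynomial (Fin r) k) ∈ polyGrading k r (-1) := by
    exact isWeightedHomogeneous_X k _ i
  have := D.smul_mem _ _ _ _ h hm
  rwa [neg_add_eq_sub] at this

theorem weight_X_smul (D : DGModule k r M) (c : ℤ → k) (i : Fin r) (m : M) :
    D.weight c ((X i : MvPolynomial (Fin r) k) • m) =
      (X i : MvPolynomial (Fin r) k) • D.weight (fun n => c (n - 1)) m := by
  induction m using D.homogeneous_induction with
  | hom n m hm =>
    rw [D.weight_of_mem _ hm, D.weight_of_mem _ (D.X_smul_mem i hm), smul_comm]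
  | add a b ha hb => simp only [map_add, smul_add, ha, hb]

theorem weight_one (D : DGModule k r M) (m : M) : D.weight 1 m = m := by
  induction m using D.homogeneous_induction with
  | hom n m hm => rw [D.weight_of_mem _ hm, Pi.one_apply, one_smul]
  | add a b ha hb => simp only [map_add, ha, hb]

theorem weight_sub (D : DGModule k r M) (c c' : ℤ → k) (m : M) :
    D.weight (c - c') m = D.weight c m - D.weight c' m := by
  induction m using D.homogeneous_induction with
  | hom n m hm => simp only [D.weight_of_mem _ hm, Pi.sub_apply, sub_smul]
  | add a b ha hb => simp only [map_add, ha, hb]; abel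

theorem weight_single_mem (D : DGModule k r M) (n : ℤ) (m : M) :
    D.weight (Pi.single n 1) m ∈ D.component n := by
  induction m using D.homogeneous_induction with
  | hom l m hm =>
    rw [D.weight_of_mem _ hm]
    rcases eq_or_ne l n with rfl | h
    · simpa using hm
    · simp [h]
  | add a b ha hb => rw [map_add]; exact add_mem ha hb

theorem weight_single_d (D : DGModule k r M) (n : ℤ) (m : M) :
    D.weight (Pi.single n 1) (D.d m) = D.d (D.weight (Pi.single (n + 1) 1) m) := by
  rw [weight_d]
  have h : (fun l => (Pi.single n 1 : ℤ → k) (l - 1)) = Pi.single (n + 1) 1 := by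
    ext l
    simp only [Pi.single_apply, sub_eq_iff_eq_add]
  rw [h]

/-- The weight which is `1` in degrees congruent to `c` modulo `2` and `0` in other degrees. -/
noncomputable def parityWeight (k : Type u) [Field k] (c n : ℤ) : k := if Even (n - c) then 1 else 0

/-- The projection onto the part of degrees congruent to `c` modulo `2`. -/
noncomputable def proj (D : DGModule k r M) (c : ℤ) : M →ₗ[k] M := D.weight (parityWeight k c)

theorem proj_proj (D : DGModule k r M) (c : ℤ) (m : M) : D.proj c (D.proj c m) = D.proj c m := by
  rw [proj, weight_mul]
  congr 2
  ext n
  simp [parityWeight]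

/-- Shifting the degree by one exchanges the parities; this makes both the differential and the
variables odd. -/
theorem parityWeight_sub_one (c : ℤ) :
    (fun n => parityWeight k c (n - 1)) = 1 - parityWeight k c := by
  ext n
  have : Even (n - 1 - c) ↔ ¬ Even (n - c) := by
    rw [sub_right_comm, Int.even_sub_one]
  by_cases h : Even (n - c) <;> simp [parityWeight, this, h]

theorem proj_d (D : DGModule k r M) (c : ℤ) (m : M) :
    D.proj c (D.d m) = D.d (m - D.proj c m) := by
  rw [proj, weight_d, parityWeight_sub_one, weight_sub, weight_one]

theorem proj_X_smul (D : DGModule k r M) (c : ℤ) (i : Fin r) (m : M) :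
    D.proj c ((X i : MvPolynomial (Fin r) k) • m) =
      (X i : MvPolynomial (Fin r) k) • (m - D.proj c m) := by
  rw [proj, weight_X_smul, parityWeight_sub_one, weight_sub, weight_one]

/-- The part of degrees congruent to `c` modulo `2`. -/
noncomputable def same (D : DGModule k r M) (c : ℤ) : Submodule k M :=
  LinearMap.ker (LinearMap.id - D.proj c)

/-- The part of degrees not congruent to `c` modulo `2`. -/
noncomputable def opposite (D : DGModule k r M) (c : ℤ) : Submodule k M :=
  LinearMap.ker (D.proj c)

theorem mem_same {D : DGModule k r M} {c : ℤ} {m : M} : m ∈ D.same c ↔ D.proj c m = m := by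
  rw [same, LinearMap.mem_ker, LinearMap.sub_apply, LinearMap.id_apply, sub_eq_zero, eq_comm]

theorem mem_opposite {D : DGModule k r M} {c : ℤ} {m : M} :
    m ∈ D.opposite c ↔ D.proj c m = 0 := Iff.rfl

theorem proj_mem_same (D : DGModule k r M) (c : ℤ) (m : M) : D.proj c m ∈ D.same c :=
  mem_same.2 (D.proj_proj c m)

theorem sub_proj_mem_opposite (D : DGModule k r M) (c : ℤ) (m : M) :
    m - D.proj c m ∈ D.opposite c := by
  rw [mem_opposite, map_sub, proj_proj, sub_self]

/-- An operator exchanging the two parity classes. -/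
structure IsOdd (D : DGModule k r M) (c : ℤ) (f : M →ₗ[k] M) : Prop where
  proj_apply : ∀ m, D.proj c (f m) = f (m - D.proj c m)

theorem IsOdd.mem_opposite {D : DGModule k r M} {c : ℤ} {f : M →ₗ[k] M} (hf : D.IsOdd c f) :
    ∀ m ∈ D.same c, f m ∈ D.opposite c := by
  intro m hm
  rw [DGModule.mem_opposite, hf.proj_apply, mem_same.1 hm, sub_self, map_zero]

theorem IsOdd.mem_same {D : DGModule k r M} {c : ℤ} {f : M →ₗ[k] M} (hf : D.IsOdd c f) :
    ∀ m ∈ D.opposite c, f m ∈ D.same c := by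
  intro m hm
  rw [DGModule.mem_same, hf.proj_apply, DGModule.mem_opposite.1 hm, sub_zero]

theorem isOdd_d (D : DGModule k r M) (c : ℤ) : D.IsOdd c (D.d.restrictScalars k) := ⟨D.proj_d c⟩

/-- Multiplication by a variable. -/
noncomputable def mulX (k : Type u) [Field k] {r : ℕ} (M : Type v) [AddCommGroup M] [Module k M]
    [Module (MvPolynomial (Fin r) k) M] [IsScalarTower k (MvPolynomial (Fin r) k) M] (i : Fin r) :
    M →ₗ[k] M :=
  (LinearMap.lsmul (MvPolynomial (Fin r) k) M (X i)).restrictScalars k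

theorem isOdd_mulX (D : DGModule k r M) (c : ℤ) (i : Fin r) : D.IsOdd c (mulX k M i) :=
  ⟨D.proj_X_smul c i⟩

theorem proj_mem_initialSubmodule (D : DGModule k r M) (c : ℤ) (j : ℕ) (hj : j ≤ r) :
    ∀ m ∈ initialSubmodule k r M j, D.proj c m ∈ initialSubmodule k r M j := by
  induction j with
  | zero =>
    rw [initialSubmodule_zero]
    rintro m rfl
    exact map_zero _
  | succ j ih =>
    intro m hm
    obtain ⟨n, hn, m', rfl⟩ := (mem_initialSubmodule_succ ⟨j, hj⟩ m).1 hm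
    refine (mem_initialSubmodule_succ ⟨j, hj⟩ _).2
      ⟨_, ih (by omega) n hn, m' - D.proj c m', ?_⟩
    rw [map_add, proj_X_smul]

/-- The part of parity `c` of the submodule generated by the first `j` variables. -/
noncomputable def sameInitial (D : DGModule k r M) (c : ℤ) (j : ℕ) : Submodule k (D.same c) :=
  ((initialSubmodule k r M j).restrictScalars k).submoduleOf (D.same c)

/-- The part of parity opposite to `c` of the submodule generated by the first `j` variables. -/
noncomputable def oppositeInitial (D : DGModule k r M) (c : ℤ) (j : ℕ) :
    Submodule k (D.opposite c) :=
  ((initialSubmodule k r M j).restrictScalars k).submoduleOf (D.opposite c)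

/-- The differential from parity `c`. -/
noncomputable def dSame (D : DGModule k r M) (c : ℤ) : D.same c →ₗ[k] D.opposite c :=
  (D.d.restrictScalars k).restrict (D.isOdd_d c).mem_opposite

/-- The differential to parity `c`. -/
noncomputable def dOpposite (D : DGModule k r M) (c : ℤ) : D.opposite c →ₗ[k] D.same c :=
  (D.d.restrictScalars k).restrict (D.isOdd_d c).mem_same

/-- Multiplication by a variable from parity `c`. -/
noncomputable def xSame (D : DGModule k r M) (c : ℤ) (i : Fin r) :
    D.same c →ₗ[k] D.opposite c :=
  (mulX k M i).restrict (D.isOdd_mulX c i).mem_opposite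

/-- Multiplication by a variable to parity `c`. -/
noncomputable def xOpposite (D : DGModule k r M) (c : ℤ) (i : Fin r) :
    D.opposite c →ₗ[k] D.same c :=
  (mulX k M i).restrict (D.isOdd_mulX c i).mem_same

theorem d_mem_initialSubmodule (D : DGModule k r M) (j : ℕ) (m : M)
    (hm : m ∈ initialSubmodule k r M j) : D.d m ∈ initialSubmodule k r M j := by
  have h : (initialSubmodule k r M j).map D.d ≤ initialSubmodule k r M j := by
    rw [initialSubmodule, Submodule.map_smul'']
    exact smul_mono_right _ le_top
  exact h ⟨m, hm, rfl⟩

theorem regularOddEndo (D : DGModule k r M) (c : ℤ) {ι : Type*}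
    (b : Module.Basis ι (MvPolynomial (Fin r) k) M) (i : Fin r) :
    RegularOddEndo (D.dSame c) (D.dOpposite c) (D.xSame c i) (D.xOpposite c i)
      (D.sameInitial c i) (D.oppositeInitial c i) where
  d'_d a := Subtype.ext (D.d_d a)
  d_d' a := Subtype.ext (D.d_d a)
  d_mem a ha := D.d_mem_initialSubmodule i a ha
  d'_mem a ha := D.d_mem_initialSubmodule i a ha
  y_d a := Subtype.ext (D.d.map_smul (X i) (a : M)).symm
  x_d' a := Subtype.ext (D.d.map_smul (X i) (a : M)).symm
  x_mem_iff a := ⟨fun h => X_smul_mem_initialSubmodule b i a h,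
    fun h => (initialSubmodule k r M i).smul_mem (X i) h⟩
  y_mem_iff a := ⟨fun h => X_smul_mem_initialSubmodule b i a h,
    fun h => (initialSubmodule k r M i).smul_mem (X i) h⟩

theorem sameInitial_succ (D : DGModule k r M) (c : ℤ) (i : Fin r) :
    D.sameInitial c (i + 1) = D.sameInitial c i ⊔ LinearMap.range (D.xOpposite c i) := by
  ext ⟨a, ha⟩
  constructor
  · intro h
    obtain ⟨n, hn, m, e⟩ := (mem_initialSubmodule_succ i a).1 h
    -- The decomposition of `a` need not respect parity, so its component of parity `c` is taken.
    have e' := congrArg (D.proj c) e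
    rw [map_add, proj_X_smul, mem_same.1 ha] at e'
    refine Submodule.mem_sup.2 ⟨⟨D.proj c n, D.proj_mem_same c n⟩,
      D.proj_mem_initialSubmodule c i i.2.le n hn, _,
      ⟨⟨_, D.sub_proj_mem_opposite c m⟩, rfl⟩, Subtype.ext e'⟩
  · intro h
    obtain ⟨n, hn, _, ⟨m, rfl⟩, e⟩ := Submodule.mem_sup.1 h
    exact (mem_initialSubmodule_succ i a).2 ⟨n, hn, m, congrArg Subtype.val e⟩

theorem oppositeInitial_succ (D : DGModule k r M) (c : ℤ) (i : Fin r) :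
    D.oppositeInitial c (i + 1) = D.oppositeInitial c i ⊔ LinearMap.range (D.xSame c i) := by
  ext ⟨a, ha⟩
  constructor
  · intro h
    obtain ⟨n, hn, m, e⟩ := (mem_initialSubmodule_succ i a).1 h
    have e' : (n - D.proj c n) + (X i : MvPolynomial (Fin r) k) • D.proj c m = a := by
      have h1 := congrArg (D.proj c) e
      rw [map_add, proj_X_smul, mem_opposite.1 ha, smul_sub] at h1
      rw [← sub_zero a, ← h1, ← e]
      abel
    refine Submodule.mem_sup.2 ⟨⟨n - D.proj c n, D.sub_proj_mem_opposite c n⟩,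
      sub_mem hn (D.proj_mem_initialSubmodule c i i.2.le n hn), _,
      ⟨⟨_, D.proj_mem_same c m⟩, rfl⟩, Subtype.ext e'⟩
  · intro h
    obtain ⟨n, hn, _, ⟨m, rfl⟩, e⟩ := Submodule.mem_sup.1 h
    exact (mem_initialSubmodule_succ i a).2 ⟨n, hn, m, congrArg Subtype.val e⟩

/-! ### Comparison of the graded homology with the two-periodic homology. -/

/-- The total homology in degrees congruent to `c` modulo `2`. -/
abbrev SameHomology (D : DGModule k r M) (c : ℤ) : Type v :=
  RelHomology (D.dSame c) (D.dOpposite c) (D.sameInitial c 0) (D.oppositeInitial c 0)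

/-- The total homology in degrees not congruent to `c` modulo `2`. -/
abbrev OppositeHomology (D : DGModule k r M) (c : ℤ) : Type v :=
  RelHomology (D.dOpposite c) (D.dSame c) (D.oppositeInitial c 0) (D.sameInitial c 0)

theorem mem_sameInitial_zero {D : DGModule k r M} {c : ℤ} {a : D.same c} :
    a ∈ D.sameInitial c 0 ↔ (a : M) = 0 := by
  change (a : M) ∈ initialSubmodule k r M 0 ↔ _
  rw [initialSubmodule_zero, Submodule.mem_bot]

theorem mem_oppositeInitial_zero {D : DGModule k r M} {c : ℤ} {a : D.opposite c} :
    a ∈ D.oppositeInitial c 0 ↔ (a : M) = 0 := by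
  change (a : M) ∈ initialSubmodule k r M 0 ↔ _
  rw [initialSubmodule_zero, Submodule.mem_bot]

/-- The projection `M → M_c`. -/
noncomputable def projSame (D : DGModule k r M) (c : ℤ) : M →ₗ[k] D.same c :=
  (D.proj c).codRestrict _ (D.proj_mem_same c)

/-- The map from the homology in degree `n` to the homology of parity `c`. -/
noncomputable def homologyToSame (D : DGModule k r M) (c n : ℤ) :
    D.homology n →ₗ[k] D.SameHomology c :=
  Subquotient.map (D.cycles n) (D.boundaries n) _ _ (D.projSame c)
    (fun z hz => by
      rw [Submodule.mem_comap, mem_oppositeInitial_zero]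
      change D.d (D.proj c z) = 0
      have h := D.proj_d c z
      rwa [show D.d z = 0 from hz.2, map_zero, map_sub, show D.d z = 0 from hz.2, zero_sub,
        eq_comm, neg_eq_zero] at h)
    (by
      rintro _ ⟨u, -, rfl⟩
      refine Submodule.mem_sup_left ⟨⟨_, D.sub_proj_mem_opposite c u⟩, Subtype.ext ?_⟩
      exact (D.proj_d c u).symm)

theorem weight_single_mem_cycles (D : DGModule k r M) (n : ℤ) {z : M} (hz : D.d z = 0) :
    D.weight (Pi.single n 1) z ∈ D.cycles n := by
  refine ⟨D.weight_single_mem n z, ?_⟩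
  have h := D.weight_single_d (n - 1) z
  rw [hz, map_zero, sub_add_cancel] at h
  exact h.symm

theorem exists_sum_weight_single (D : DGModule k r M) (m : M) :
    ∃ s : Finset ℤ, m = ∑ n ∈ s, D.weight (Pi.single n 1) m := by
  classical
  obtain ⟨f, hf, e⟩ := (Submodule.mem_iSup_iff_exists_finsupp D.component m).1
    (D.isInternal.submodule_iSup_eq_top ▸ Submodule.mem_top)
  have h (n : ℤ) : D.weight (Pi.single n 1) m = f n := by
    rw [← e, Finsupp.sum, map_sum]
    simp only [D.weight_of_mem _ (hf _), Pi.single_apply, ite_smul, one_smul, zero_smul]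
    simpa using fun h => h.symm
  exact ⟨f.support, by simp only [h]; exact e.symm⟩

theorem finite_sameHomology (D : DGModule k r M) (c : ℤ)
    (hfin : Module.Finite k (⨁ n : ℤ, D.homology n)) : Module.Finite k (D.SameHomology c) := by
  classical
  refine Module.Finite.of_surjective (DirectSum.toModule k ℤ _ (D.homologyToSame c)) ?_
  rw [← LinearMap.range_eq_top, eq_top_iff]
  intro q _
  obtain ⟨⟨⟨z, hz⟩, hd⟩, rfl⟩ := Submodule.Quotient.mk_surjective _ q
  have hd' : D.d z = 0 := by
    rw [Submodule.mem_comap, mem_oppositeInitial_zero] at hd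
    exact hd
  obtain ⟨s, hs⟩ := D.exists_sum_weight_single z
  -- The homogeneous components of a cycle are cycles; those of the wrong parity are killed by the
  -- projection.
  refine ⟨∑ n ∈ s, DirectSum.lof k ℤ D.homology n
    (Submodule.Quotient.mk ⟨_, D.weight_single_mem_cycles n hd'⟩), ?_⟩
  simp only [map_sum, DirectSum.toModule_lof]
  change ∑ n ∈ s, (Submodule.mkQ _) _ = (Submodule.mkQ _) _
  rw [← map_sum]
  congr 1
  apply Subtype.ext
  apply Subtype.ext
  simp only [AddSubmonoidClass.coe_finsetSum]
  change ∑ n ∈ s, D.proj c (D.weight (Pi.single n 1) z) = z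
  rw [← map_sum, ← hs]
  exact mem_same.1 hz

theorem nontrivial_sameHomology (D : DGModule k r M) (c : ℤ) (h : Nontrivial (D.homology c)) :
    Nontrivial (D.SameHomology c) := by
  refine (Function.Injective.nontrivial (f := D.homologyToSame c c) ?_)
  rw [injective_iff_map_eq_zero]
  intro q hq
  obtain ⟨⟨z, hz⟩, rfl⟩ := Submodule.Quotient.mk_surjective _ q
  have h1 := (Subquotient.mk_eq_zero_iff _).1 hq
  obtain ⟨_, ⟨⟨b, hb⟩, rfl⟩, n, hn, e⟩ := Submodule.mem_sup.1 h1
  rw [mem_sameInitial_zero] at hn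
  have hp : D.proj c z = z := by
    rw [proj, D.weight_of_mem _ hz.1]
    simp [parityWeight]
  have e' : D.d b + n = D.proj c z := congrArg Subtype.val e
  rw [hn, add_zero, hp] at e'
  refine (Subquotient.mk_eq_zero_iff (P := D.cycles c) _).2 ?_
  -- The primitive `b` is only known to have the opposite parity; its component of degree `c + 1`
  -- already bounds `z`.
  refine ⟨D.weight (Pi.single (c + 1) 1) b, D.weight_single_mem _ _, ?_⟩
  change D.d _ = z
  rw [← weight_single_d, e', D.weight_of_mem _ hz.1, Pi.single_eq_same, one_smul]

theorem subsingleton_oppositeHomology (D : DGModule k r M) (c : ℤ)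
    (h : ∀ n, Nontrivial (D.homology n) → c ≡ n [ZMOD 2]) :
    Subsingleton (D.OppositeHomology c) := by
  refine subsingleton_of_forall_eq 0 fun q => ?_
  obtain ⟨⟨⟨z, hz⟩, hd⟩, rfl⟩ := Submodule.Quotient.mk_surjective _ q
  have hd' : D.d z = 0 := by
    rw [Submodule.mem_comap, mem_sameInitial_zero] at hd
    exact hd
  have hb (n : ℤ) : D.weight (Pi.single n 1) z ∈ LinearMap.range D.d := by
    -- In degrees of parity `c` the component of `z` is zero; in the others the homology vanishes,
    -- so it is a boundary.
    by_cases hn : Even (n - c)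
    · have : D.weight (Pi.single n 1) z = D.weight (Pi.single n 1) (D.proj c z) := by
        rw [proj, weight_mul]
        congr 2
        ext l
        rcases eq_or_ne l n with rfl | hl
        · simp [parityWeight, hn]
        · simp [hl]
      rw [this, mem_opposite.1 hz, map_zero]
      exact zero_mem _
    · have ht : ¬ Nontrivial (D.homology n) := fun hN => hn (by
        rw [Int.even_iff]
        have := h n hN
        unfold Int.ModEq at this
        omega)
      have := not_nontrivial_iff_subsingleton.1 ht
      have h0 := (Subquotient.mk_eq_zero_iff (Q := D.boundaries n)
        ⟨_, D.weight_single_mem_cycles n hd'⟩).1 (Subsingleton.elim _ _)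
      obtain ⟨u, -, hu⟩ := h0
      exact ⟨u, hu⟩
  obtain ⟨s, hs⟩ := D.exists_sum_weight_single z
  obtain ⟨u, hu⟩ : z ∈ LinearMap.range D.d := by
    rw [hs]
    exact Submodule.sum_mem _ fun n _ => hb n
  refine (Subquotient.mk_eq_zero_iff _).2 (Submodule.mem_sup_left
    ⟨⟨_, D.proj_mem_same c u⟩, Subtype.ext ?_⟩)
  change D.d (D.proj c u) = z
  have h1 := D.proj_d c u
  rw [hu, mem_opposite.1 hz, map_sub, hu, eq_comm, sub_eq_zero] at h1
  exact h1.symm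

/-! ### The rank bound. -/

theorem finite_and_finrank_same_quotient_le (D : DGModule k r M) (c : ℤ) {ι : Type*} [Fintype ι]
    (b : Module.Basis ι (MvPolynomial (Fin r) k) M) :
    Module.Finite k (D.same c ⧸ D.sameInitial c r) ∧
      Module.finrank k (D.same c ⧸ D.sameInitial c r) ≤ Fintype.card ι := by
  refine finite_and_finrank_le b ((D.sameInitial c r).mkQ ∘ₗ D.projSame c) ?_ ?_
  · refine (Submodule.mkQ_surjective _).comp fun a => ⟨a, Subtype.ext (mem_same.1 a.2)⟩
  · intro m hm
    exact (Submodule.Quotient.mk_eq_zero _).2 (D.proj_mem_initialSubmodule c r le_rfl m hm)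

theorem two_pow_le_card (D : DGModule k r M) {ι : Type*} [Fintype ι]
    (b : Module.Basis ι (MvPolynomial (Fin r) k) M)
    (hfin : Module.Finite k (⨁ n : ℤ, D.homology n)) (c : ℤ) (hc : Nontrivial (D.homology c))
    (h : ∀ n, Nontrivial (D.homology n) → c ≡ n [ZMOD 2]) : 2 ^ r ≤ Fintype.card ι := by
  have fA := D.finite_sameHomology c hfin
  have := D.nontrivial_sameHomology c hc
  have := D.subsingleton_oppositeHomology c h
  obtain ⟨-, -, e⟩ := euler_char_regular_sequence (D.regularOddEndo c b) (D.sameInitial_succ c)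
    (D.oppositeInitial_succ c) fA inferInstance r le_rfl
  obtain ⟨fQ, hQ⟩ := D.finite_and_finrank_same_quotient_le c b
  have h1 := finrank_relHomology_le (D.dSame c) (D.dOpposite c) (D.sameInitial c r)
    (D.oppositeInitial c r)
  have h2 : 0 < Module.finrank k (D.SameHomology c) := Module.finrank_pos
  have h3 : Module.finrank k (D.OppositeHomology c) = 0 := Module.finrank_zero_of_subsingleton
  rw [h3] at e
  zify at *
  have h4 : (2 : ℤ) ^ r * 1 ≤ 2 ^ r * Module.finrank k (D.SameHomology c) := by
    gcongr
    exact h2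
  rw [sub_zero] at e
  linarith

end DGModule

theorem theorem1 {k : Type u} [Field k] [IsAlgClosed k] [CharP k 2] (r : ℕ)
    {M : Type v} [AddCommGroup M] [Module k M] [Module (MvPolynomial (Fin r) k) M]
    [IsScalarTower k (MvPolynomial (Fin r) k) M]
    (D : DGModule k r M) (hfree : D.IsSemifree)
    (hne : Nontrivial (⨁ n : ℤ, D.homology n))
    (hfin : Module.Finite k (⨁ n : ℤ, D.homology n))
    (hparity : ∀ n m : ℤ, Nontrivial (D.homology n) → Nontrivial (D.homology m) →
      n ≡ m [ZMOD 2]) :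
    (2 : Cardinal.{v}) ^ r ≤ Module.rank (MvPolynomial (Fin r) k) M := by
  obtain ⟨ι, b, -⟩ := hfree
  obtain ⟨c, hc⟩ : ∃ c, Nontrivial (D.homology c) := by
    by_contra! hall
    obtain ⟨q, hq⟩ := exists_ne (0 : ⨁ n : ℤ, D.homology n)
    exact hq (DFinsupp.ext fun n => (hall n).elim _ _)
  rw [← b.mk_eq_rank'']
  rcases finite_or_infinite ι with hι | hι
  · have := Fintype.ofFinite ι
    rw [Cardinal.mk_fintype]
    exact_mod_cast D.two_pow_le_card b hfin c hc fun n hn => hparity c n hc hn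
  -- For infinite rank the bound holds because `2 ^ r` is finite.
  · refine le_trans ?_ (Cardinal.aleph0_le_mk ι)
    exact_mod_cast (Cardinal.natCast_lt_aleph0 (n := 2 ^ r)).le
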